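/- Let $(X,d)$ be a complete CAT(0) space, i.e. a complete metric space in which any two points are joined by a geodesic and $d(z,m)^2\le\frac12d(z,x)^2+\frac12d(z,y)^2-\frac14d(x,y)^2$ whenever $d(x,m)=d(y,m)=\frac12d(x,y)$. For $x,y\in X$ and $t\in[0,1]$ let $(1-t)x\oplus ty$ denote the unique point $z$ with $d(x,z)=t\,d(x,y)$ and $d(y,z)=(1-t)\,d(x,y)$. Let $C\subseteq X$ be closed, bounded and convex (i.e. $(1-t)x\oplus ty\in C$ for all $x,y\in C$ and $t\in[0,1]$), let $T:C\to C$ be nonexpansive, let $u,x\in C$, and let $M\ge1$ be an integer with $M\ge\operatorname{diam}C$. Put $\lambda_n=\frac1{n+1}$ for $n\ge1$, and let $(x_n)_{n\ge0}$ be the Halpern iteration $$x_0=x,\qquad x_{n+1}=\lambda_{n+1}u\oplus(1-\lambda_{n+1})Tx_n .$$ Then for all $\varepsilon\in(0,1)$ and all $g:\mathbb N\to\mathbb N$ (with $\mathbb N=\{0,1,2,\dots\}$) $$\exists N\le\Sigma(\varepsilon,g,M)\ \ \forall m,n\in[N,N+g(N)]\quad d(x_n,x_m)\le\varepsilon ,$$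 where $$\Sigma(\varepsilon,g,M)=\left\lceil\frac{12M^2\left(\chi^*_L(\varepsilon^2/12)+1\right)}{\varepsilon^2}\right\rceil-1,\qquad L=\widetilde{f^*}^{\left(\lceil M^2/\varepsilon_0^2\rceil\right)}(0)+\left\lceil\frac1{\varepsilon_0}\right\rceil,\qquad \varepsilon_0=\frac{\varepsilon^2}{24(M+1)^2},$$ $h^{(i)}$ denotes the $i$-th iterate of $h$, and, for $k\in\mathbb N$ and $\delta\in(0,1)$, $$\tilde P_k(\delta)=\left\lceil\frac{12M^2(k+1)}{\delta}\left(\left\lceil\frac{48M(k+1)}{\delta}+\frac{2304M^4(k+1)^2}{\delta^2}\right\rceil-1\right)\right\rceil,$$ $$\chi^*_k(\delta)=\left\lceil\frac{8M^2(\tilde P_k(\delta/2)+1)}{\delta}+\frac{128M^4(\tilde P_k(\delta/2)+1)^2}{\delta^2}\right\rceil-1+\tilde P_k(\delta/2),$$ $$\Theta_k(\delta)=\left\lceil\frac{3M^2(\chi^*_k(\delta/3)+1)}{\delta}\right\rceil-1,\qquad g_{\delta,k}(n)=n+g\left(n+\chi^*_k(\delta/3)\right),$$ $$\Delta^*_k(\delta,g)=\frac{\delta}{3\,g_{\delta,k}\left(\Theta_k(\delta)-\chi^*_k(\delta/3)\right)},\qquad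 f(k)=\max\left\{\left\lceil\frac{M^2}{\Delta^*_k(\varepsilon^2/4,g)}\right\rceil,k\right\}-k,$$ $$f^*(k)=f\left(k+\left\lceil\frac1{\varepsilon_0}\right\rceil\right)+\left\lceil\frac1{\varepsilon_0}\right\rceil,\qquad \widetilde{f^*}(k)=k+f^*(k).$$ -/

import Mathlib

noncomputable section

namespace HalpernCAT0

/-- A CAT(0) space: a geodesic metric space satisfying the CN inequality of Bruhat and Tits.
No completeness is required here. -/
class CAT0Space (X : Type*) [MetricSpace X] : Prop where
  geodesic : ∀ x y : X, ∃ γ : ℝ → X, γ 0 = x ∧ γ (dist x y) = y ∧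
    ∀ s ∈ Set.Icc (0 : ℝ) (dist x y), ∀ t ∈ Set.Icc (0 : ℝ) (dist x y),
      dist (γ s) (γ t) = |s - t|
  cn : ∀ x y z m : X, dist x m = 1 / 2 * dist x y → dist y m = 1 / 2 * dist x y →
    dist z m ^ 2 ≤ 1 / 2 * dist z x ^ 2 + 1 / 2 * dist z y ^ 2 - 1 / 4 * dist x y ^ 2

variable {X : Type*} [MetricSpace X]

theorem exists_comb [CAT0Space X] (x y : X) {t : ℝ} (ht : t ∈ Set.Icc (0 : ℝ) 1) :
    ∃ z : X, dist x z = t * dist x y ∧ dist y z = (1 - t) * dist x y := by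
  obtain ⟨γ, h0, h1, hγ⟩ := CAT0Space.geodesic x y
  have hd : 0 ≤ dist x y := dist_nonneg
  have m0 : (0 : ℝ) ∈ Set.Icc (0 : ℝ) (dist x y) := ⟨le_rfl, hd⟩
  have m1 : dist x y ∈ Set.Icc (0 : ℝ) (dist x y) := ⟨hd, le_rfl⟩
  have mt : t * dist x y ∈ Set.Icc (0 : ℝ) (dist x y) :=
    ⟨mul_nonneg ht.1 hd, mul_le_of_le_one_left hd ht.2⟩
  refine ⟨γ (t * dist x y), ?_, ?_⟩
  · have h := hγ _ m0 _ mt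
    rw [h0] at h
    rw [h, zero_sub, abs_neg, abs_of_nonneg mt.1]
  · have h := hγ _ m1 _ mt
    rw [h1] at h
    rw [h, abs_of_nonneg (by linarith [mt.2])]
    ring

/-- In a CAT(0) space the point described in `exists_comb` is unique. -/
theorem comb_unique [CAT0Space X] {x y z w : X} {t : ℝ}
    (hz1 : dist x z = t * dist x y) (hz2 : dist y z = (1 - t) * dist x y)
    (hw1 : dist x w = t * dist x y) (hw2 : dist y w = (1 - t) * dist x y) : z = w := by
  obtain ⟨m, hm1, hm2⟩ := exists_comb z w (t := 1 / 2) ⟨by norm_num, by norm_num⟩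
  have e2 : dist w m = 1 / 2 * dist z w := by rw [hm2]; ring
  have c1 := CAT0Space.cn z w x m hm1 e2
  have c2 := CAT0Space.cn z w y m hm1 e2
  have tri := dist_triangle_right x y m
  rw [hz1, hw1] at c1
  rw [hz2, hw2] at c2
  have p1 : 0 ≤ t * dist x y := hz1 ▸ dist_nonneg
  have p2 : 0 ≤ (1 - t) * dist x y := hz2 ▸ dist_nonneg
  have q1 : dist x m ≤ t * dist x y :=
    abs_le_of_sq_le_sq' (by nlinarith [sq_nonneg (dist z w)]) p1 |>.2
  have q2 : dist y m ≤ (1 - t) * dist x y :=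
    abs_le_of_sq_le_sq' (by nlinarith [sq_nonneg (dist z w)]) p2 |>.2
  have r1 : dist x m = t * dist x y := by linarith
  rw [r1] at c1
  have h0 : dist z w ^ 2 ≤ 0 := by linarith
  exact dist_eq_zero.mp (pow_eq_zero_iff (two_ne_zero) |>.mp (le_antisymm h0 (sq_nonneg _)))

open Classical in
/-- The convex combination `(1 - t) x ⊕ t y`: for `t ∈ [0, 1]`, the point `z` of the geodesic
segment `[x, y]` with `d(x, z) = t d(x, y)` and `d(y, z) = (1 - t) d(x, y)`. -/
def comb [CAT0Space X] (x y : X) (t : ℝ) : X :=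
  if ht : t ∈ Set.Icc (0 : ℝ) 1 then Classical.choose (exists_comb x y ht) else x

theorem dist_comb [CAT0Space X] (x y : X) {t : ℝ} (ht : t ∈ Set.Icc (0 : ℝ) 1) :
    dist x (comb x y t) = t * dist x y ∧ dist y (comb x y t) = (1 - t) * dist x y := by
  rw [comb, dif_pos ht]
  exact Classical.choose_spec (exists_comb x y ht)

/-- `C` is convex: it contains the segment `[x, y]` for all `x, y ∈ C`. -/
def GeodConvex [CAT0Space X] (C : Set X) : Prop :=
  ∀ x ∈ C, ∀ y ∈ C, ∀ t ∈ Set.Icc (0 : ℝ) 1, comb x y t ∈ C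

/-- The Halpern iteration `x₀ = x`, `xₙ₊₁ = λₙ₊₁ u ⊕ (1 - λₙ₊₁) T xₙ`. -/
def halpern [CAT0Space X] (T : X → X) (lam : ℕ → ℝ) (u x : X) : ℕ → X
  | 0 => x
  | n + 1 => comb u (T (halpern T lam u x n)) (1 - lam (n + 1))

/-! The constants and functionals of the bound. They are only used with `ε > 0` and `M ≥ 1`, where
every rounded-up real number below is positive, so that subtracting `1` in `ℕ` is the ordinary
subtraction. -/

/-- `P̃ₖ(ε)`. -/
def Ptilde (M k : ℕ) (ε : ℝ) : ℕ :=
  ⌈12 * (M : ℝ) ^ 2 * (k + 1) / ε *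
    ((⌈48 * (M : ℝ) * (k + 1) / ε + 2304 * (M : ℝ) ^ 4 * (k + 1) ^ 2 / ε ^ 2⌉₊ - 1 : ℕ) : ℝ)⌉₊

/-- `χ*ₖ(ε)`. -/
def chiStar (M k : ℕ) (ε : ℝ) : ℕ :=
  ⌈8 * (M : ℝ) ^ 2 * ((Ptilde M k (ε / 2) : ℝ) + 1) / ε +
    128 * (M : ℝ) ^ 4 * ((Ptilde M k (ε / 2) : ℝ) + 1) ^ 2 / ε ^ 2⌉₊ - 1 + Ptilde M k (ε / 2)

/-- `Θₖ(ε)`. -/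
def Theta (M k : ℕ) (ε : ℝ) : ℕ :=
  ⌈3 * (M : ℝ) ^ 2 * ((chiStar M k (ε / 3) : ℝ) + 1) / ε⌉₊ - 1

/-- `g_{ε,k}(n) = n + g(n + χ*ₖ(ε/3))`. -/
def gEps (M : ℕ) (g : ℕ → ℕ) (k : ℕ) (ε : ℝ) (n : ℕ) : ℕ :=
  n + g (n + chiStar M k (ε / 3))

/-- `Δ*ₖ(ε, g)`. For `0 < ε < 3` and `M ≥ 1` one has `Θₖ(ε) > χ*ₖ(ε/3)`, so that the subtraction
is not truncated and the denominator is positive; it is used at `ε²/4 < 1`. -/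
def DeltaStar (M : ℕ) (g : ℕ → ℕ) (k : ℕ) (ε : ℝ) : ℝ :=
  ε / (3 * (gEps M g k ε (Theta M k ε - chiStar M k (ε / 3)) : ℝ))

/-- `ε₀ = ε² / (24 (M + 1)²)`. -/
def eps0 (M : ℕ) (ε : ℝ) : ℝ := ε ^ 2 / (24 * ((M : ℝ) + 1) ^ 2)

/-- `f(k) = max {⌈M² / Δ*ₖ(ε²/4, g)⌉, k} - k`. -/
def fFun (M : ℕ) (ε : ℝ) (g : ℕ → ℕ) (k : ℕ) : ℕ :=
  max ⌈(M : ℝ) ^ 2 / DeltaStar M g k (ε ^ 2 / 4)⌉₊ k - k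

/-- `f*(k) = f(k + ⌈1/ε₀⌉) + ⌈1/ε₀⌉`. -/
def fStar (M : ℕ) (ε : ℝ) (g : ℕ → ℕ) (k : ℕ) : ℕ :=
  fFun M ε g (k + ⌈1 / eps0 M ε⌉₊) + ⌈1 / eps0 M ε⌉₊

/-- The function `k ↦ k + f*(k)`. -/
def fStarTilde (M : ℕ) (ε : ℝ) (g : ℕ → ℕ) (k : ℕ) : ℕ := k + fStar M ε g k

/-- `L`: the `⌈M²/ε₀²⌉`-fold iterate of `fStarTilde` at `0`, plus `⌈1/ε₀⌉`. -/
def Lnum (M : ℕ) (ε : ℝ) (g : ℕ → ℕ) : ℕ :=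
  (fStarTilde M ε g)^[⌈(M : ℝ) ^ 2 / eps0 M ε ^ 2⌉₊] 0 + ⌈1 / eps0 M ε⌉₊

/-- `Σ(ε, g, M) = ⌈12 M² (χ*_L(ε²/12) + 1) / ε²⌉ - 1`. -/
def SigmaBound (ε : ℝ) (g : ℕ → ℕ) (M : ℕ) : ℕ :=
  ⌈12 * (M : ℝ) ^ 2 * ((chiStar M (Lnum M ε g) (ε ^ 2 / 12) : ℝ) + 1) / ε ^ 2⌉₊ - 1

end HalpernCAT0

end

/-!
Browder's approximants `z k`, the fixed points of `y ↦ u / (k + 1) ⊕ (k / (k + 1)) T y`, satisfy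
`dist (z k) (z j) ^ 2 ≤ dist u (z j) ^ 2 - dist u (z k) ^ 2` for `k ≤ j`
(`NonexpansiveOn.sq_dist_approximant_le`). The right-hand side is the increment of a bounded
monotone sequence, so that for every prescribed way of choosing `j` in terms of `k` some `z k` and
`z j` are close, with a bound on `k` that is an iterate of the choice function
(`NonexpansiveOn.exists_close_approximants`).

The squared distance of the Halpern iterates `x n` to `z j` satisfies a recursion with weights
`(n + 1) / (n + 2)`, an inhomogeneous term `dist u (z j) ^ 2 - (n + 1) / (n + 2) * dist u (T (x n)) ^ 2`
and an error `M ^ 2 / (j + 1)` per step. The inhomogeneous term is eventually small: the CN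
inequality bounds `dist u (z k) ^ 2 - dist u (x n) ^ 2` by `2 M (k + 1) * dist (x n) (T (x n))`, and
`dist (x n) (T (x n)) ≤ 3 M / √(n + 2)` (`NonexpansiveOn.dist_halpern_map_le`). This rate depends on
`k` only, while the accumulated error is small for `n` up to a bound that depends on `j`. Taking `z k`
and `z j` close, with `j` large in terms of `k` and of `g`, gives `dist (z j) (x n) ≤ ε / 2` for all
`n` in the required interval (`NonexpansiveOn.sq_dist_halpern_le_quarter`).

The functional `chiStar` is much larger than the rate that this argument needs; only the lower bound
`le_chiStar` and its monotonicity in the index enter. No Banach limits or averages are used.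
-/

namespace HalpernCAT0

variable {X : Type*} [MetricSpace X] [CAT0Space X]

/-! ### Convex combinations in CAT(0) spaces -/

theorem eq_comb {x y z : X} {t : ℝ} (ht : t ∈ Set.Icc (0 : ℝ) 1)
    (h1 : dist x z = t * dist x y) (h2 : dist y z = (1 - t) * dist x y) : z = comb x y t :=
  comb_unique h1 h2 (dist_comb x y ht).1 (dist_comb x y ht).2

theorem comb_symm (x y : X) {t : ℝ} (ht : t ∈ Set.Icc (0 : ℝ) 1) :
    comb y x (1 - t) = comb x y t := by
  have h := dist_comb y x (t := 1 - t) ⟨by linarith [ht.2], by linarith [ht.1]⟩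
  refine eq_comb ht ?_ ?_
  · rw [h.2, dist_comm y x]; ring
  · rw [h.1, dist_comm y x]

theorem dist_comb_comb (x y : X) {s t : ℝ} (hs : s ∈ Set.Icc (0 : ℝ) 1)
    (ht : t ∈ Set.Icc (0 : ℝ) 1) :
    dist (comb x y s) (comb x y t) = |s - t| * dist x y := by
  obtain ⟨γ, h0, h1, hγ⟩ := CAT0Space.geodesic x y
  have hd : 0 ≤ dist x y := dist_nonneg
  have mem : ∀ r ∈ Set.Icc (0 : ℝ) 1, r * dist x y ∈ Set.Icc (0 : ℝ) (dist x y) := fun r hr =>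
    ⟨mul_nonneg hr.1 hd, mul_le_of_le_one_left hd hr.2⟩
  have key : ∀ r ∈ Set.Icc (0 : ℝ) 1, γ (r * dist x y) = comb x y r := by
    intro r hr
    refine eq_comb hr ?_ ?_
    · have h := hγ 0 ⟨le_rfl, hd⟩ _ (mem r hr)
      rw [h0] at h
      rw [h, zero_sub, abs_neg, abs_of_nonneg (mem r hr).1]
    · have h := hγ _ ⟨hd, le_rfl⟩ _ (mem r hr)
      rw [h1] at h
      rw [h, abs_of_nonneg (by linarith [(mem r hr).2])]
      ring
  rw [← key s hs, ← key t ht, hγ _ (mem s hs) _ (mem t ht), ← sub_mul, abs_mul, abs_of_nonneg hd]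

/-- The amount by which `z` violates the CN inequality at the point `comb x y t`: the left-hand side
minus the right-hand side. -/
noncomputable def cnDefect (z x y : X) (t : ℝ) : ℝ :=
  dist z (comb x y t) ^ 2 -
    ((1 - t) * dist z x ^ 2 + t * dist z y ^ 2 - t * (1 - t) * dist x y ^ 2)

theorem cnDefect_symm (z x y : X) {t : ℝ} (ht : t ∈ Set.Icc (0 : ℝ) 1) :
    cnDefect z y x (1 - t) = cnDefect z x y t := by
  rw [cnDefect, cnDefect, comb_symm x y ht, dist_comm y x]
  ring

/-- `comb x y t` is the midpoint of `x` and `comb x y (2 * t)`. -/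
theorem cnDefect_le_half_double (z x y : X) {t : ℝ} (h0 : 0 ≤ t) (h1 : t ≤ 1 / 2) :
    cnDefect z x y t ≤ cnDefect z x y (2 * t) / 2 := by
  have ht : t ∈ Set.Icc (0 : ℝ) 1 := ⟨h0, by linarith⟩
  have ht2 : 2 * t ∈ Set.Icc (0 : ℝ) 1 := ⟨by linarith, by linarith⟩
  have e1 := (dist_comb x y ht).1
  have e2 := (dist_comb x y ht2).1
  have e3 := dist_comb_comb x y ht2 ht
  rw [abs_of_nonneg (by linarith)] at e3
  have h := CAT0Space.cn x (comb x y (2 * t)) z (comb x y t) (by rw [e1, e2]; ring)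
    (by rw [e3, e2]; ring)
  rw [e2] at h
  unfold cnDefect
  linarith

theorem cnDefect_le_half_bound (z x y : X) {B : ℝ}
    (hB : ∀ t ∈ Set.Icc (0 : ℝ) 1, cnDefect z x y t ≤ B) :
    ∀ t ∈ Set.Icc (0 : ℝ) 1, cnDefect z x y t ≤ B / 2 := by
  intro t ht
  rcases le_total t (1 / 2) with h | h
  · linarith [cnDefect_le_half_double z x y ht.1 h,
      hB (2 * t) ⟨by linarith [ht.1], by linarith⟩]
  · have h1 := cnDefect_le_half_double z y x (t := 1 - t) (by linarith [ht.2]) (by linarith)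
    have h2 := cnDefect_symm z x y (t := 2 * t - 1) ⟨by linarith, by linarith [ht.2]⟩
    rw [cnDefect_symm z x y ht, show 2 * (1 - t) = 1 - (2 * t - 1) by ring, h2] at h1
    linarith [hB (2 * t - 1) ⟨by linarith, by linarith [ht.2]⟩]

theorem exists_cnDefect_le (z x y : X) :
    ∃ B, ∀ t ∈ Set.Icc (0 : ℝ) 1, cnDefect z x y t ≤ B := by
  refine ⟨(dist z x + dist x y) ^ 2 + dist x y ^ 2, fun t ht => ?_⟩
  have e := (dist_comb x y ht).1
  have tri := dist_triangle z x (comb x y t)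
  have h1 : dist z (comb x y t) ≤ dist z x + dist x y := by
    nlinarith [ht.1, ht.2, dist_nonneg (x := x) (y := y)]
  have h2 := pow_le_pow_left₀ dist_nonneg h1 2
  have h3 : 0 ≤ (1 - t) * dist z x ^ 2 := mul_nonneg (by linarith [ht.2]) (sq_nonneg _)
  have h4 : 0 ≤ t * dist z y ^ 2 := mul_nonneg ht.1 (sq_nonneg _)
  have h5 : t * (1 - t) * dist x y ^ 2 ≤ 1 * dist x y ^ 2 :=
    mul_le_mul_of_nonneg_right (by nlinarith [sq_nonneg t, ht.2]) (sq_nonneg _)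
  unfold cnDefect
  linarith

/-- The CN inequality at an arbitrary point of a segment. An upper bound for the defect along the
segment can be halved, because every point is the midpoint of an endpoint and another point of the
segment; hence the least upper bound is not positive. -/
theorem sq_dist_comb_le (z x y : X) {t : ℝ} (ht : t ∈ Set.Icc (0 : ℝ) 1) :
    dist z (comb x y t) ^ 2 ≤
      (1 - t) * dist z x ^ 2 + t * dist z y ^ 2 - t * (1 - t) * dist x y ^ 2 := by
  obtain ⟨B, hB⟩ := exists_cnDefect_le z x y
  set S := cnDefect z x y '' Set.Icc (0 : ℝ) 1
  have hbdd : BddAbove S := ⟨B, by rintro _ ⟨t, ht, rfl⟩; exact hB t ht⟩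
  have hle : ∀ t ∈ Set.Icc (0 : ℝ) 1, cnDefect z x y t ≤ sSup S := fun t ht =>
    le_csSup hbdd ⟨t, ht, rfl⟩
  have hhalf : sSup S ≤ sSup S / 2 := by
    refine csSup_le ⟨_, t, ht, rfl⟩ ?_
    rintro _ ⟨r, hr, rfl⟩
    exact cnDefect_le_half_bound z x y hle r hr
  have h := hle t ht
  unfold cnDefect at h
  linarith

/-- Two segments with a common endpoint: apply the CN inequality on each of them in turn. -/
theorem dist_comb_le (u a b : X) {s : ℝ} (hs : s ∈ Set.Icc (0 : ℝ) 1) :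
    dist (comb u a s) (comb u b s) ≤ s * dist a b := by
  have h1 := sq_dist_comb_le b u a hs
  have h2 := sq_dist_comb_le (comb u a s) u b hs
  rw [dist_comm (comb u a s) u, (dist_comb u a hs).1, dist_comm (comb u a s) b] at h2
  rw [dist_comm b u, dist_comm b a] at h1
  have h3 := mul_le_mul_of_nonneg_left h1 hs.1
  refine abs_le_of_sq_le_sq' ?_ (mul_nonneg hs.1 dist_nonneg) |>.2
  linarith

theorem sq_dist_le_add {Y : Type*} [MetricSpace Y] {u a b : Y} {M : ℝ}
    (ha : dist u a ≤ M) (hb : dist u b ≤ M) :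
    dist u a ^ 2 ≤ dist u b ^ 2 + 2 * M * dist a b := by
  have h1 := dist_triangle_right u a b
  have h2 : 0 ≤ dist u a + dist u b := by positivity
  have h3 : (dist u a - dist u b) * (dist u a + dist u b) ≤
      dist a b * (dist u a + dist u b) := mul_le_mul_of_nonneg_right (by linarith) h2
  have h4 : dist a b * (dist u a + dist u b) ≤ dist a b * (2 * M) :=
    mul_le_mul_of_nonneg_left (by linarith) dist_nonneg
  nlinarith

/-! ### Nonexpansive maps and Browder's approximants -/

/-- `T` is a nonexpansive self-map of the convex set `C`, the anchor `u` lies in `C`, and any two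
points of `C` have distance at most `M`. -/
structure NonexpansiveOn (C : Set X) (T : X → X) (u : X) (M : ℝ) : Prop where
  conv : GeodConvex C
  maps : Set.MapsTo T C C
  dist_map_le : ∀ x ∈ C, ∀ y ∈ C, dist (T x) (T y) ≤ dist x y
  anchor_mem : u ∈ C
  dist_le : ∀ x ∈ C, ∀ y ∈ C, dist x y ≤ M

variable {C : Set X} {T : X → X} {u : X} {M : ℝ}

/-- The contraction `y ↦ comb u (T y) α` has a fixed point in `C`. -/
theorem NonexpansiveOn.exists_approximant (h : NonexpansiveOn C T u M) (hC : IsComplete C)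
    {α : ℝ} (h0 : 0 ≤ α) (h1 : α < 1) : ∃ a ∈ C, a = comb u (T a) α := by
  have hα : α ∈ Set.Icc (0 : ℝ) 1 := ⟨h0, h1.le⟩
  have hmaps : Set.MapsTo (fun y => comb u (T y) α) C C := fun y hy =>
    h.conv u h.anchor_mem _ (h.maps hy) α hα
  have hcontr : ContractingWith ⟨α, h0⟩ (hmaps.restrict _ C C) := by
    refine ⟨h1, LipschitzWith.of_dist_le_mul fun y z => ?_⟩
    refine (dist_comb_le u (T y) (T z) hα).trans ?_
    exact mul_le_mul_of_nonneg_left (h.dist_map_le y y.2 z z.2) h0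
  obtain ⟨a, ha, hfix, -⟩ :=
    hcontr.exists_fixedPoint' hC hmaps h.anchor_mem (edist_ne_top _ _)
  exact ⟨a, ha, hfix.symm⟩

/-- Browder's monotonicity: the squared distance between two approximants is at most the increase
of their squared distances to the anchor. -/
theorem NonexpansiveOn.sq_dist_approximant_le (h : NonexpansiveOn C T u M) {a b : X} {α β : ℝ}
    (ha : a ∈ C) (hb : b ∈ C) (h0 : 0 ≤ α) (hαβ : α < β) (h1 : β ≤ 1)
    (hfa : a = comb u (T a) α) (hfb : b = comb u (T b) β) :
    dist a b ^ 2 ≤ dist u b ^ 2 - dist u a ^ 2 := by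
  have hα : α ∈ Set.Icc (0 : ℝ) 1 := ⟨h0, by linarith⟩
  have hβ : β ∈ Set.Icc (0 : ℝ) 1 := ⟨by linarith, h1⟩
  have c1 := sq_dist_comb_le (T b) u (T a) hα
  have c2 := sq_dist_comb_le a u (T b) hβ
  have e1 := (dist_comb u (T a) hα).1
  have e2 := (dist_comb u (T b) hβ).1
  rw [← hfa] at c1 e1
  rw [← hfb] at c2 e2
  have hD : dist (T b) (T a) ^ 2 ≤ dist a b ^ 2 := by
    rw [dist_comm a b]
    exact pow_le_pow_left₀ dist_nonneg (h.dist_map_le b hb a ha) 2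
  rw [dist_comm (T b) u, dist_comm (T b) a] at c1
  rw [dist_comm a u] at c2
  rw [e1] at c2 ⊢
  rw [e2]
  generalize dist a b ^ 2 = D at *
  have hD0 : 0 ≤ D := le_trans (sq_nonneg _) hD
  generalize dist u (T a) = p at *
  generalize dist u (T b) = q at *
  have c1' : dist a (T b) ^ 2 ≤ (1 - α) * q ^ 2 + α * D - α * (1 - α) * p ^ 2 := by
    nlinarith
  have c3 : D * (1 - α * β) ≤ (β - α) * (β * q ^ 2 - α * p ^ 2) := by
    nlinarith [mul_le_mul_of_nonneg_left c1' hβ.1]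
  have c4 : D * (1 - α * β) * β ≤ (β - α) * ((β * q) ^ 2 - (α * p) ^ 2) := by
    have := mul_le_mul_of_nonneg_right c3 hβ.1
    have h5 : 0 ≤ (β - α) * (β - α) * α * p ^ 2 := by
      have := sub_nonneg.2 hαβ.le
      positivity
    nlinarith
  have c5 : β - α ≤ (1 - α * β) * β := by
    nlinarith [mul_nonneg h0 (mul_nonneg (sub_nonneg.2 h1) (by linarith : 0 ≤ 1 + β))]
  refine le_of_mul_le_mul_left ?_ (sub_pos.2 hαβ)
  nlinarith [mul_le_mul_of_nonneg_left c5 hD0]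

/-- An approximant is, up to the displacement of `y`, no farther from the anchor than `y` is. -/
theorem NonexpansiveOn.mul_sq_dist_approximant_le (h : NonexpansiveOn C T u M) {a y : X} {t : ℝ}
    (ha : a ∈ C) (hy : y ∈ C) (ht : t ∈ Set.Icc (0 : ℝ) 1) (hfa : a = comb u (T a) (1 - t)) :
    t * dist u a ^ 2 ≤ t * dist u y ^ 2 + 2 * M * dist y (T y) := by
  have ht' : 1 - t ∈ Set.Icc (0 : ℝ) 1 := ⟨by linarith [ht.2], by linarith [ht.1]⟩
  have c := sq_dist_comb_le y u (T a) ht'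
  have e := (dist_comb u (T a) ht').1
  rw [← hfa] at c e
  have hM : 0 ≤ M := dist_nonneg.trans (h.dist_le a ha a ha)
  have c2 := sq_dist_le_add (h.dist_le _ (h.maps ha) _ hy) (h.dist_le _ (h.maps ha) _ (h.maps hy))
  have c3 : dist (T a) (T y) ^ 2 ≤ dist y a ^ 2 := by
    rw [dist_comm y a]
    exact pow_le_pow_left₀ dist_nonneg (h.dist_map_le a ha y hy) 2
  rw [dist_comm y u, dist_comm y (T a)] at c
  rw [e]
  have hr : 0 ≤ 2 * M * dist y (T y) := by positivity
  have c4 := mul_le_mul_of_nonneg_left (c2.trans (add_le_add_left c3 _)) ht'.1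
  have c5 : 0 ≤ t * (2 * M * dist y (T y)) := mul_nonneg ht.1 hr
  have c6 : 0 ≤ t * dist y a ^ 2 := mul_nonneg ht.1 (sq_nonneg _)
  have c7 : 0 ≤ t * t * (1 - t) * dist u (T a) ^ 2 := by
    have := ht.1
    have := ht'.1
    positivity
  nlinarith

/-- One step of the Halpern iteration, measured from an approximant. -/
theorem NonexpansiveOn.sq_dist_comb_approximant_le (h : NonexpansiveOn C T u M) {a y : X}
    {s t : ℝ} (ha : a ∈ C) (hy : y ∈ C) (hs : s ∈ Set.Icc (0 : ℝ) 1) (ht : t ∈ Set.Icc (0 : ℝ) 1)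
    (hfa : a = comb u (T a) (1 - t)) :
    dist a (comb u (T y) s) ^ 2 ≤
      s * (dist a y ^ 2 + t * M ^ 2) + (1 - s) * (dist u a ^ 2 - s * dist u (T y) ^ 2) := by
  have ht' : 1 - t ∈ Set.Icc (0 : ℝ) 1 := ⟨by linarith [ht.2], by linarith [ht.1]⟩
  have c1 := sq_dist_comb_le a u (T y) hs
  have c2 := sq_dist_comb_le (T y) u (T a) ht'
  rw [← hfa] at c2
  have c3 : dist (T y) (T a) ^ 2 ≤ dist a y ^ 2 := by
    rw [dist_comm a y]
    exact pow_le_pow_left₀ dist_nonneg (h.dist_map_le y hy a ha) 2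
  have c4 : dist (T y) u ^ 2 ≤ M ^ 2 :=
    pow_le_pow_left₀ dist_nonneg (h.dist_le _ (h.maps hy) _ h.anchor_mem) 2
  have c5 : 0 ≤ (1 - t) * (1 - (1 - t)) * dist u (T a) ^ 2 :=
    mul_nonneg (mul_nonneg ht'.1 (by linarith [ht.1])) (sq_nonneg _)
  have c6 : dist a (T y) ^ 2 ≤ dist a y ^ 2 + t * M ^ 2 := by
    rw [dist_comm a (T y)]
    nlinarith [mul_le_mul_of_nonneg_left c3 ht'.1, mul_le_mul_of_nonneg_left c4 ht.1,
      mul_nonneg ht.1 (sq_nonneg (dist a y))]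
  rw [dist_comm a u] at c1
  nlinarith [mul_le_mul_of_nonneg_left c6 hs.1]

/-! ### The Halpern iteration -/

theorem NonexpansiveOn.halpern_mem (h : NonexpansiveOn C T u M) {x : ℕ → X} (h0 : x 0 ∈ C)
    (hx : ∀ n : ℕ, x (n + 1) = comb u (T (x n)) (((n : ℝ) + 1) / (n + 2))) (n : ℕ) :
    x n ∈ C := by
  induction n with
  | zero => exact h0
  | succ n ih =>
    rw [hx]
    refine h.conv u h.anchor_mem _ (h.maps ih) _ ⟨by positivity, ?_⟩
    rw [div_le_one (by positivity)]
    linarith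

theorem weight_mem (n : ℕ) : ((n : ℝ) + 1) / (n + 2) ∈ Set.Icc (0 : ℝ) 1 := by
  refine ⟨by positivity, ?_⟩
  rw [div_le_one (by positivity)]
  linarith

theorem NonexpansiveOn.mul_dist_halpern_succ_le (h : NonexpansiveOn C T u M) {x : ℕ → X}
    (h0 : x 0 ∈ C)
    (hx : ∀ n : ℕ, x (n + 1) = comb u (T (x n)) (((n : ℝ) + 1) / (n + 2))) (n : ℕ) :
    ((n : ℝ) + 3) * dist (x (n + 1)) (x (n + 2)) ≤
      (n + 2) * dist (x n) (x (n + 1)) + M / (n + 2) := by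
  have hmem := h.halpern_mem h0 hx
  have w1 := weight_mem n
  have w2 := weight_mem (n + 1)
  have e1 := dist_comb_comb u (T (x n)) w1 w2
  have e2 := (dist_comb_le u (T (x n)) (T (x (n + 1))) w2)
  have tri := dist_triangle (x (n + 1))
    (comb u (T (x n)) (((n + 1 : ℕ) + 1 : ℝ) / ((n + 1 : ℕ) + 2)))
    (x (n + 2))
  rw [← hx n] at e1
  rw [e1] at tri
  rw [← hx (n + 1)] at e2
  have e3 := h.dist_map_le _ (hmem n) _ (hmem (n + 1))
  have e4 := h.dist_le _ h.anchor_mem _ (h.maps (hmem n))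
  have hd : |((n : ℝ) + 1) / (n + 2) - (((n + 1 : ℕ) : ℝ) + 1) / ((n + 1 : ℕ) + 2)| =
      1 / ((n + 2) * (n + 3)) := by
    rw [abs_sub_comm, abs_of_nonneg]
    · push_cast
      field_simp
      ring
    · push_cast
      rw [sub_nonneg, div_le_div_iff₀ (by positivity) (by positivity)]
      nlinarith
  rw [hd] at tri
  have e5 : dist (x (n + 1)) (x (n + 2)) ≤
      1 / (((n : ℝ) + 2) * (n + 3)) * M + (n + 2) / (n + 3) * dist (x n) (x (n + 1)) := by
    refine tri.trans (add_le_add (mul_le_mul_of_nonneg_left e4 (by positivity)) (e2.trans ?_))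
    have : (((n + 1 : ℕ) : ℝ) + 1) / ((n + 1 : ℕ) + 2) = (n + 2) / (n + 3) := by
      push_cast
      ring
    rw [this]
    exact mul_le_mul_of_nonneg_left e3 (by positivity)
  calc ((n : ℝ) + 3) * dist (x (n + 1)) (x (n + 2)) ≤ ((n : ℝ) + 3) *
      (1 / (((n : ℝ) + 2) * (n + 3)) * M + (n + 2) / (n + 3) * dist (x n) (x (n + 1))) :=
        mul_le_mul_of_nonneg_left e5 (by positivity)
    _ = _ := by field_simp; ring

theorem inv_le_two_mul_sqrt_sub {a : ℝ} (ha : 2 ≤ a) :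
    1 / a ≤ 2 * (√(a + 1) - √a) := by
  have hs : √a ^ 2 = a := Real.sq_sqrt (by linarith)
  have h1 : 1 ≤ √a := Real.one_le_sqrt.2 (by linarith)
  have key : √a + 1 / (2 * a) ≤ √(a + 1) := by
    refine Real.le_sqrt_of_sq_le ?_
    have h2 : √a ≤ a - 1 / 4 := by nlinarith [sq_nonneg (√a - 3 / 2)]
    have h3 : (√a + 1 / (2 * a)) ^ 2 = a + (√a + 1 / (4 * a)) / a := by
      have : a ≠ 0 := by linarith
      rw [add_sq, hs]
      field_simp
      ring
    have h4 : 1 / (4 * a) ≤ 1 / 4 := by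
      rw [div_le_div_iff₀ (by linarith) (by norm_num)]
      linarith
    rw [h3]
    have : (√a + 1 / (4 * a)) / a ≤ 1 := by
      rw [div_le_one (by linarith)]
      linarith
    linarith
  have : 1 / a = 2 * (1 / (2 * a)) := by field_simp
  linarith

theorem NonexpansiveOn.mul_dist_halpern_le (h : NonexpansiveOn C T u M) {x : ℕ → X}
    (h0 : x 0 ∈ C)
    (hx : ∀ n : ℕ, x (n + 1) = comb u (T (x n)) (((n : ℝ) + 1) / (n + 2))) (n : ℕ) :
    ((n : ℝ) + 2) * dist (x n) (x (n + 1)) ≤ 2 * M * √(n + 2) := by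
  have hM : 0 ≤ M := dist_nonneg.trans (h.dist_le _ h0 _ h0)
  induction n with
  | zero =>
    have h1 := h.dist_le _ h0 _ (h.halpern_mem h0 hx 1)
    have h2 : (1 : ℝ) ≤ √(((0 : ℕ) : ℝ) + 2) := Real.one_le_sqrt.2 (by norm_num)
    push_cast at h2 ⊢
    nlinarith
  | succ n ih =>
    have h1 := h.mul_dist_halpern_succ_le h0 hx n
    have h2 := inv_le_two_mul_sqrt_sub (a := (n : ℝ) + 2) (by linarith [n.cast_nonneg (α := ℝ)])
    have h3 := mul_le_mul_of_nonneg_left h2 hM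
    rw [mul_one_div] at h3
    push_cast
    rw [show (n : ℝ) + 1 + 2 = n + 2 + 1 by ring]
    rw [show (n : ℝ) + 3 = n + 2 + 1 by ring] at h1
    linarith

/-- A rate of asymptotic regularity. -/
theorem NonexpansiveOn.dist_halpern_map_le (h : NonexpansiveOn C T u M) {x : ℕ → X}
    (h0 : x 0 ∈ C)
    (hx : ∀ n : ℕ, x (n + 1) = comb u (T (x n)) (((n : ℝ) + 1) / (n + 2))) (n : ℕ) :
    dist (x n) (T (x n)) * √(n + 2) ≤ 3 * M := by
  have hM : 0 ≤ M := dist_nonneg.trans (h.dist_le _ h0 _ h0)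
  have hmem := h.halpern_mem h0 hx
  have h1 := h.mul_dist_halpern_le h0 hx n
  have e := (dist_comb u (T (x n)) (weight_mem n)).2
  rw [← hx] at e
  have tri := dist_triangle_right (x n) (T (x n)) (x (n + 1))
  have e4 := h.dist_le _ h.anchor_mem _ (h.maps (hmem n))
  have hs : √((n : ℝ) + 2) ^ 2 = n + 2 := Real.sq_sqrt (by positivity)
  have hs1 : 1 ≤ √((n : ℝ) + 2) := Real.one_le_sqrt.2 (by linarith [n.cast_nonneg (α := ℝ)])
  have e5 : ((n : ℝ) + 2) * dist (T (x n)) (x (n + 1)) ≤ M := by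
    have : (1 : ℝ) - ((n : ℝ) + 1) / (n + 2) = 1 / (n + 2) := by field_simp; ring
    rw [e, this, ← mul_assoc, mul_one_div_cancel (by positivity), one_mul]
    exact e4
  refine le_of_mul_le_mul_right ?_ (lt_of_lt_of_le one_pos hs1)
  rw [mul_assoc, ← pow_two, hs]
  nlinarith [mul_le_mul_of_nonneg_left tri (by positivity : 0 ≤ (n : ℝ) + 2)]

/-- The upper estimate for the inhomogeneous term of the recursion for `dist a (x n) ^ 2`: it tends
to `0` for every approximant `a` with a fixed parameter. -/
theorem NonexpansiveOn.sq_dist_sub_le (h : NonexpansiveOn C T u M) {x : ℕ → X} (h0 : x 0 ∈ C)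
    (hx : ∀ n : ℕ, x (n + 1) = comb u (T (x n)) (((n : ℝ) + 1) / (n + 2))) {a : X} {k : ℕ}
    (ha : a ∈ C) (hfa : a = comb u (T a) (1 - 1 / ((k : ℝ) + 1))) (n : ℕ) :
    (dist u a ^ 2 - ((n : ℝ) + 1) / (n + 2) * dist u (T (x n)) ^ 2) * √(n + 2) ≤
      13 * M ^ 2 * (k + 1) := by
  have hM : 0 ≤ M := dist_nonneg.trans (h.dist_le _ h0 _ h0)
  have hy := h.halpern_mem h0 hx n
  have hr := h.dist_halpern_map_le h0 hx n
  have ht : 1 / ((k : ℝ) + 1) ∈ Set.Icc (0 : ℝ) 1 := by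
    refine ⟨by positivity, ?_⟩
    rw [div_le_one (by positivity)]
    linarith [k.cast_nonneg (α := ℝ)]
  have hs : √((n : ℝ) + 2) ^ 2 = n + 2 := Real.sq_sqrt (by positivity)
  have hs1 : 1 ≤ √((n : ℝ) + 2) := Real.one_le_sqrt.2 (by linarith [n.cast_nonneg (α := ℝ)])
  have c1 := h.mul_sq_dist_approximant_le ha hy ht hfa
  have c1' : dist u a ^ 2 ≤ dist u (x n) ^ 2 + 2 * M * dist (x n) (T (x n)) * (k + 1) := by
    have := mul_le_mul_of_nonneg_left c1 (by positivity : 0 ≤ (k : ℝ) + 1)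
    rw [mul_add, ← mul_assoc, ← mul_assoc, mul_one_div_cancel (by positivity)] at this
    linarith
  have c2 := sq_dist_le_add (h.dist_le _ h.anchor_mem _ hy)
    (h.dist_le _ h.anchor_mem _ (h.maps hy))
  have c3 : dist u (T (x n)) ^ 2 ≤ M ^ 2 :=
    pow_le_pow_left₀ dist_nonneg (h.dist_le _ h.anchor_mem _ (h.maps hy)) 2
  have c4 : dist u (T (x n)) ^ 2 - ((n : ℝ) + 1) / (n + 2) * dist u (T (x n)) ^ 2 ≤
      M ^ 2 / (n + 2) := by
    have : dist u (T (x n)) ^ 2 - ((n : ℝ) + 1) / (n + 2) * dist u (T (x n)) ^ 2 =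
        dist u (T (x n)) ^ 2 / (n + 2) := by field_simp; ring
    rw [this]
    gcongr
  have c5 : M ^ 2 / ((n : ℝ) + 2) * √(n + 2) ≤ M ^ 2 := by
    rw [div_mul_eq_mul_div, div_le_iff₀ (by positivity)]
    nlinarith [mul_le_mul_of_nonneg_left hs1 (by positivity : 0 ≤ M ^ 2 * √((n : ℝ) + 2))]
  have c6 : dist u a ^ 2 - ((n : ℝ) + 1) / (n + 2) * dist u (T (x n)) ^ 2 ≤
      2 * M * (k + 2) * dist (x n) (T (x n)) + M ^ 2 / (n + 2) := by linarith
  have c7 := mul_le_mul_of_nonneg_right c6 (by linarith : 0 ≤ √((n : ℝ) + 2))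
  have c8 := mul_le_mul_of_nonneg_left hr (by positivity : 0 ≤ 2 * M * ((k : ℝ) + 2))
  have c9 : 0 ≤ M ^ 2 * k := by positivity
  nlinarith

/-- Unrolling the recursion from the index `P` on. -/
theorem NonexpansiveOn.mul_sq_dist_halpern_le (h : NonexpansiveOn C T u M) {x : ℕ → X}
    (h0 : x 0 ∈ C)
    (hx : ∀ n : ℕ, x (n + 1) = comb u (T (x n)) (((n : ℝ) + 1) / (n + 2))) {a : X} {t β : ℝ}
    (ha : a ∈ C) (ht : t ∈ Set.Icc (0 : ℝ) 1) (hfa : a = comb u (T a) (1 - t)) {P : ℕ}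
    (hβ : ∀ n ≥ P, dist u a ^ 2 - ((n : ℝ) + 1) / (n + 2) * dist u (T (x n)) ^ 2 ≤ β) (i : ℕ) :
    ((P + i : ℕ) + 1 : ℝ) * dist a (x (P + i)) ^ 2 ≤
      (P + 1) * M ^ 2 + i * ((P + i : ℕ) + 1) * (t * M ^ 2) + i * β := by
  have hmem := h.halpern_mem h0 hx
  induction i with
  | zero =>
    have := pow_le_pow_left₀ dist_nonneg (h.dist_le a ha _ (hmem P)) 2
    have := mul_le_mul_of_nonneg_left this (by positivity : 0 ≤ (P : ℝ) + 1)
    simpa using this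
  | succ i ih =>
    rw [← add_assoc]
    set n := P + i with hn
    have c1 := h.sq_dist_comb_approximant_le ha (hmem n) (weight_mem n) ht hfa
    rw [← hx] at c1
    have c2 := hβ n (by omega)
    have c3 : ((n : ℝ) + 2) * dist a (x (n + 1)) ^ 2 ≤
        (n + 1) * (dist a (x n) ^ 2 + t * M ^ 2) + β := by
      have e1 : 1 - ((n : ℝ) + 1) / (n + 2) = 1 / (n + 2) := by field_simp; ring
      rw [e1] at c1
      calc ((n : ℝ) + 2) * dist a (x (n + 1)) ^ 2
          ≤ ((n : ℝ) + 2) * _ := mul_le_mul_of_nonneg_left c1 (by positivity)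
        _ = (n + 1) * (dist a (x n) ^ 2 + t * M ^ 2) +
            (dist u a ^ 2 - ((n : ℝ) + 1) / (n + 2) * dist u (T (x n)) ^ 2) := by
            field_simp
        _ ≤ _ := by linarith
    have c4 : 0 ≤ t * M ^ 2 := mul_nonneg ht.1 (sq_nonneg _)
    have c5 : 0 ≤ ((i : ℝ) + 1) * (t * M ^ 2) := by positivity
    push_cast
    nlinarith

theorem NonexpansiveOn.sq_dist_halpern_le (h : NonexpansiveOn C T u M) {x : ℕ → X}
    (h0 : x 0 ∈ C)
    (hx : ∀ n : ℕ, x (n + 1) = comb u (T (x n)) (((n : ℝ) + 1) / (n + 2))) {a : X} {t β : ℝ}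
    (ha : a ∈ C) (ht : t ∈ Set.Icc (0 : ℝ) 1) (hfa : a = comb u (T a) (1 - t)) (hβ0 : 0 ≤ β)
    {P n : ℕ}
    (hβ : ∀ n ≥ P, dist u a ^ 2 - ((n : ℝ) + 1) / (n + 2) * dist u (T (x n)) ^ 2 ≤ β)
    (hn : P ≤ n) :
    dist a (x n) ^ 2 ≤ (P + 1) * M ^ 2 / (n + 1) + (n - P : ℕ) * (t * M ^ 2) + β := by
  have c := h.mul_sq_dist_halpern_le h0 hx ha ht hfa hβ (n - P)
  rw [Nat.add_sub_cancel' hn] at c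
  have c1 : ((n - P : ℕ) : ℝ) * β ≤ (n + 1) * β := by
    refine mul_le_mul_of_nonneg_right ?_ hβ0
    have : ((n - P : ℕ) : ℝ) ≤ n := by exact_mod_cast Nat.sub_le n P
    linarith
  refine le_of_mul_le_mul_left ?_ (by positivity : 0 < (n : ℝ) + 1)
  have e : ((n : ℝ) + 1) * ((P + 1) * M ^ 2 / (n + 1) + (n - P : ℕ) * (t * M ^ 2) + β) =
      (P + 1) * M ^ 2 + (n - P : ℕ) * (n + 1) * (t * M ^ 2) + (n + 1) * β := by
    field_simp
  rw [e]
  linarith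

/-! ### The bounds -/

theorem Ptilde_mono (M : ℕ) {k l : ℕ} (hkl : k ≤ l) {δ : ℝ} (hδ : 0 < δ) :
    Ptilde M k δ ≤ Ptilde M l δ := by
  unfold Ptilde
  gcongr

theorem chiStar_mono (M : ℕ) {k l : ℕ} (hkl : k ≤ l) {δ : ℝ} (hδ : 0 < δ) :
    chiStar M k δ ≤ chiStar M l δ := by
  have h := Ptilde_mono M hkl (half_pos hδ)
  unfold chiStar
  gcongr

theorem Theta_mono (M : ℕ) {k l : ℕ} (hkl : k ≤ l) {δ : ℝ} (hδ : 0 < δ) :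
    Theta M k δ ≤ Theta M l δ := by
  have h := chiStar_mono M hkl (show 0 < δ / 3 by positivity)
  unfold Theta
  gcongr

theorem Theta_Lnum (M : ℕ) (ε : ℝ) (g : ℕ → ℕ) :
    Theta M (Lnum M ε g) (ε ^ 2 / 4) = SigmaBound ε g M := by
  unfold Theta SigmaBound
  rw [show ε ^ 2 / 4 / 3 = ε ^ 2 / 12 by ring]
  congr 2
  rw [div_div_eq_mul_div]
  ring

theorem natCast_ceil_sub_one_le (A : ℝ) : A - 1 ≤ ((⌈A⌉₊ - 1 : ℕ) : ℝ) := by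
  have h1 := Nat.le_ceil A
  have h2 : (⌈A⌉₊ : ℝ) ≤ ((⌈A⌉₊ - 1 : ℕ) : ℝ) + 1 := by exact_mod_cast (by omega)
  linarith

theorem le_chiStar {M : ℕ} (hM : 0 < M) (k : ℕ) {δ : ℝ} (h0 : 0 < δ) (h1 : δ ≤ 1) :
    (96 * (M : ℝ) ^ 2 * (k + 1) / δ) ^ 2 ≤ chiStar M k δ := by
  have hM1 : (1 : ℝ) ≤ M := by exact_mod_cast hM
  have hk : (1 : ℝ) ≤ (k : ℝ) + 1 := by linarith [k.cast_nonneg (α := ℝ)]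
  have hP : (96 * (M : ℝ) ^ 2 * (k + 1) / δ) ^ 2 ≤ Ptilde M k (δ / 2) := by
    refine le_trans ?_ (Nat.le_ceil _)
    have hA := natCast_ceil_sub_one_le (48 * (M : ℝ) * (k + 1) / (δ / 2) +
      2304 * (M : ℝ) ^ 4 * (k + 1) ^ 2 / (δ / 2) ^ 2)
    have e1 : 1 ≤ 48 * (M : ℝ) * (k + 1) / (δ / 2) := by
      rw [le_div_iff₀ (by positivity)]
      nlinarith
    have e2 : 1 ≤ 12 * (M : ℝ) ^ 2 * (k + 1) / (δ / 2) := by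
      rw [le_div_iff₀ (by positivity)]
      nlinarith [one_le_pow₀ hM1 (n := 2)]
    have e3 : 2304 * (M : ℝ) ^ 4 * (k + 1) ^ 2 / (δ / 2) ^ 2 =
        (96 * (M : ℝ) ^ 2 * (k + 1) / δ) ^ 2 := by
      field_simp
      ring
    rw [e3] at hA ⊢
    exact (by linarith : _ ≤ _).trans (le_mul_of_one_le_left (Nat.cast_nonneg _) e2)
  refine hP.trans ?_
  unfold chiStar
  exact_mod_cast Nat.le_add_left _ _

theorem mul_le_Theta_add_one (M k : ℕ) {δ : ℝ} :
    3 * (M : ℝ) ^ 2 * (chiStar M k (δ / 3) + 1) / δ ≤ Theta M k δ + 1 := by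
  have := natCast_ceil_sub_one_le (3 * (M : ℝ) ^ 2 * ((chiStar M k (δ / 3) : ℝ) + 1) / δ)
  unfold Theta
  linarith

theorem chiStar_le_Theta {M : ℕ} (hM : 0 < M) (k : ℕ) {δ : ℝ} (h0 : 0 < δ) (h1 : δ ≤ 1) :
    chiStar M k (δ / 3) ≤ Theta M k δ := by
  have h := mul_le_Theta_add_one M k (δ := δ)
  rw [div_le_iff₀ h0] at h
  have hM1 : (1 : ℝ) ≤ (M : ℝ) ^ 2 := one_le_pow₀ (by exact_mod_cast hM)
  have hc : (0 : ℝ) ≤ chiStar M k (δ / 3) := Nat.cast_nonneg _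
  have ht : (0 : ℝ) ≤ Theta M k δ := Nat.cast_nonneg _
  have : (chiStar M k (δ / 3) : ℝ) ≤ Theta M k δ := by nlinarith
  exact_mod_cast this

/-- Among `n` consecutive steps of a sequence with values in `[0, B]`, one increases it by at most
`B / n`. -/
theorem exists_step_le {h : ℕ → ℝ} {B η : ℝ} {n : ℕ} (hB : ∀ i, h i ≤ B) (h0 : ∀ i, 0 ≤ h i)
    (hn : 0 < n) (hη : B ≤ n * η) : ∃ i < n, h (i + 1) - h i ≤ η := by
  by_contra! hc
  have h1 : ∑ _i ∈ Finset.range n, η < ∑ i ∈ Finset.range n, (h (i + 1) - h i) :=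
    Finset.sum_lt_sum_of_nonempty (Finset.nonempty_range_iff.2 hn.ne')
      fun i hi => hc i (Finset.mem_range.1 hi)
  rw [Finset.sum_range_sub, Finset.sum_const, Finset.card_range, nsmul_eq_mul] at h1
  linarith [hB n, h0 0]

theorem fStarTilde_eq (M : ℕ) (ε : ℝ) (g : ℕ → ℕ) (k : ℕ) :
    fStarTilde M ε g k = max ⌈(M : ℝ) ^ 2 /
      DeltaStar M g (k + ⌈1 / eps0 M ε⌉₊) (ε ^ 2 / 4)⌉₊ (k + ⌈1 / eps0 M ε⌉₊) := by
  unfold fStarTilde fStar fFun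
  omega

/-- Metastability of Browder's approximants `z`: two of them are `ε₀`-close, the first of index
`k ≤ L`, the second of an index that is large in terms of `k` and the counterfunction. -/
theorem NonexpansiveOn.exists_close_approximants {M : ℕ} (h : NonexpansiveOn C T u M)
    (hM : 0 < M) {z : ℕ → X} (hz : ∀ k, z k ∈ C)
    (hfz : ∀ k : ℕ, z k = comb u (T (z k)) (1 - 1 / ((k : ℝ) + 1)))
    {ε : ℝ} (hε : 0 < ε) (g : ℕ → ℕ) :
    ∃ k ≤ Lnum M ε g, ∃ j : ℕ, (M : ℝ) ^ 2 / DeltaStar M g k (ε ^ 2 / 4) ≤ j ∧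
      dist (z k) (z j) ≤ eps0 M ε := by
  have hε0 : 0 < eps0 M ε := by unfold eps0; positivity
  have hMr : (0 : ℝ) < M := by exact_mod_cast hM
  have hincr : ∀ k l : ℕ, k ≤ l →
      dist (z k) (z l) ^ 2 ≤ dist u (z l) ^ 2 - dist u (z k) ^ 2 := by
    intro k l hkl
    rcases hkl.eq_or_lt with rfl | hlt
    · simp
    refine h.sq_dist_approximant_le (hz k) (hz l) ?_ ?_ ?_ (hfz k) (hfz l)
    · rw [sub_nonneg, div_le_one (by positivity)]
      linarith [k.cast_nonneg (α := ℝ)]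
    · have : (k : ℝ) < l := by exact_mod_cast hlt
      gcongr
    · linarith [show (0 : ℝ) ≤ 1 / ((l : ℝ) + 1) by positivity]
  have hmono : ∀ k l : ℕ, k ≤ l → dist u (z k) ^ 2 ≤ dist u (z l) ^ 2 := fun k l hkl => by
    linarith [hincr k l hkl, sq_nonneg (dist (z k) (z l))]
  set F := fStarTilde M ε g with hF
  have hFle : ∀ k, k ≤ F k := fun k => Nat.le_add_right _ _
  set n := ⌈(M : ℝ) ^ 2 / eps0 M ε ^ 2⌉₊ with hn
  have hn0 : 0 < n := Nat.ceil_pos.2 (by positivity)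
  obtain ⟨i, hi, hstep⟩ := exists_step_le (h := fun i => dist u (z (F^[i] 0)) ^ 2)
    (B := (M : ℝ) ^ 2) (η := eps0 M ε ^ 2) (n := n)
    (fun i => pow_le_pow_left₀ dist_nonneg (h.dist_le _ h.anchor_mem _ (hz _)) 2)
    (fun i => sq_nonneg _) hn0 (by
      rw [← div_le_iff₀ (by positivity)]
      exact Nat.le_ceil _)
  simp only [Function.iterate_succ_apply'] at hstep
  set r := F^[i] 0 with hr
  set c := ⌈1 / eps0 M ε⌉₊ with hc
  have hFr := fStarTilde_eq M ε g r
  rw [← hF, ← hc] at hFr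
  have hle : r + c ≤ F r := hFr ▸ le_max_right _ _
  refine ⟨r + c, ?_, F r, ?_, ?_⟩
  · refine Nat.add_le_add_right ?_ c
    exact Function.monotone_iterate_of_id_le hFle hi.le 0
  · exact (Nat.le_ceil _).trans (by exact_mod_cast hFr ▸ le_max_left _ _)
  · refine abs_le_of_sq_le_sq' ?_ hε0.le |>.2
    linarith [hincr _ _ hle, hmono r (r + c) (Nat.le_add_right _ _)]

/-- From `chiStar` on, the inhomogeneous term is small for an approximant `b` that is `ε₀`-close to
an approximant `a` of index `k`. -/
theorem NonexpansiveOn.sq_dist_sub_le_third {M : ℕ} (h : NonexpansiveOn C T u M) (hM : 0 < M)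
    {x : ℕ → X} (h0 : x 0 ∈ C)
    (hx : ∀ n : ℕ, x (n + 1) = comb u (T (x n)) (((n : ℝ) + 1) / (n + 2))) {a b : X} {k : ℕ}
    (ha : a ∈ C) (hb : b ∈ C) (hfa : a = comb u (T a) (1 - 1 / ((k : ℝ) + 1))) {ε : ℝ}
    (hε : 0 < ε) (hε1 : ε < 1) (hab : dist a b ≤ eps0 M ε) {n : ℕ}
    (hn : chiStar M k (ε ^ 2 / 4 / 3) ≤ n) :
    dist u b ^ 2 - ((n : ℝ) + 1) / (n + 2) * dist u (T (x n)) ^ 2 ≤ ε ^ 2 / 4 / 3 := by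
  have hM1 : (1 : ℝ) ≤ M := by exact_mod_cast hM
  set δ := ε ^ 2 / 4 / 3 with hδ
  have hδ0 : 0 < δ := by positivity
  have hδ1 : δ ≤ 1 := by rw [hδ]; nlinarith
  have c1 := sq_dist_le_add (h.dist_le _ h.anchor_mem _ hb) (h.dist_le _ h.anchor_mem _ ha)
  rw [dist_comm b a] at c1
  have c2 : 2 * (M : ℝ) * dist a b ≤ δ / 4 := by
    refine (mul_le_mul_of_nonneg_left hab (by positivity)).trans ?_
    have : eps0 M ε = δ / (2 * ((M : ℝ) + 1) ^ 2) := by rw [eps0, hδ]; field_simp; ring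
    rw [this, mul_div_assoc', div_le_div_iff₀ (by positivity) (by norm_num)]
    nlinarith [mul_nonneg hδ0.le (sq_nonneg ((M : ℝ) - 1))]
  have c3 := h.sq_dist_sub_le h0 hx ha hfa n
  have hw : 96 * (M : ℝ) ^ 2 * (k + 1) / δ ≤ √((n : ℝ) + 2) := by
    refine Real.le_sqrt_of_sq_le ((le_chiStar hM k hδ0 hδ1).trans ?_)
    have : (chiStar M k δ : ℝ) ≤ n := by exact_mod_cast hn
    linarith
  have hw0 : 0 < √((n : ℝ) + 2) := by positivity
  rw [div_le_iff₀ hδ0] at hw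
  have c4 : dist u a ^ 2 - ((n : ℝ) + 1) / (n + 2) * dist u (T (x n)) ^ 2 ≤ δ * (3 / 4) := by
    refine le_of_mul_le_mul_right ?_ hw0
    have : (0 : ℝ) ≤ (M : ℝ) ^ 2 * (k + 1) := by positivity
    nlinarith
  linarith

/-- On the required interval after `Theta M k (ε ^ 2 / 4)` the iterates are `ε / 2`-close to `b`: the
initial term, the accumulated error and the inhomogeneous term contribute a third of `ε ^ 2 / 4`
each. -/
theorem NonexpansiveOn.sq_dist_halpern_le_quarter {M : ℕ} (h : NonexpansiveOn C T u M)
    (hM : 0 < M) {x : ℕ → X} (h0 : x 0 ∈ C)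
    (hx : ∀ n : ℕ, x (n + 1) = comb u (T (x n)) (((n : ℝ) + 1) / (n + 2))) {a b : X} {k j : ℕ}
    (ha : a ∈ C) (hb : b ∈ C) (hfa : a = comb u (T a) (1 - 1 / ((k : ℝ) + 1)))
    (hfb : b = comb u (T b) (1 - 1 / ((j : ℝ) + 1))) {ε : ℝ}
    (hε : 0 < ε) (hε1 : ε < 1) (hab : dist a b ≤ eps0 M ε) (g : ℕ → ℕ)
    (hj : (M : ℝ) ^ 2 / DeltaStar M g k (ε ^ 2 / 4) ≤ j) {n : ℕ}
    (hn : n ∈ Set.Icc (Theta M k (ε ^ 2 / 4))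
      (Theta M k (ε ^ 2 / 4) + g (Theta M k (ε ^ 2 / 4)))) :
    dist b (x n) ^ 2 ≤ ε ^ 2 / 4 := by
  set δ := ε ^ 2 / 4 with hδ
  have hδ0 : 0 < δ := by positivity
  have hδ1 : δ ≤ 1 := by rw [hδ]; nlinarith
  have hPΘ := chiStar_le_Theta hM k hδ0 hδ1
  set P := chiStar M k (δ / 3) with hP
  have ht : 1 / ((j : ℝ) + 1) ∈ Set.Icc (0 : ℝ) 1 := by
    refine ⟨by positivity, ?_⟩
    rw [div_le_one (by positivity)]
    linarith [j.cast_nonneg (α := ℝ)]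
  have key := h.sq_dist_halpern_le h0 hx hb ht hfb (by positivity : 0 ≤ δ / 3) (P := P)
    (fun n hn => h.sq_dist_sub_le_third hM h0 hx ha hb hfa hε hε1 hab hn) (hPΘ.trans hn.1)
  have t1 : ((P : ℝ) + 1) * (M : ℝ) ^ 2 / (n + 1) ≤ δ / 3 := by
    have e := mul_le_Theta_add_one M k (δ := δ)
    rw [div_le_iff₀ hδ0, ← hP] at e
    have e2 : (Theta M k δ : ℝ) ≤ n := by exact_mod_cast hn.1
    rw [div_le_iff₀ (by positivity)]
    nlinarith
  have t2 : ((n - P : ℕ) : ℝ) * (1 / ((j : ℝ) + 1) * (M : ℝ) ^ 2) ≤ δ / 3 := by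
    have e1 : n - P ≤ gEps M g k δ (Theta M k δ - P) := by
      rw [gEps, ← hP, Nat.sub_add_cancel hPΘ]
      have := hn.2
      omega
    have e2 : ((n - P : ℕ) : ℝ) ≤ gEps M g k δ (Theta M k δ - P) := by exact_mod_cast e1
    rw [DeltaStar, ← hP, div_div_eq_mul_div, div_le_iff₀ hδ0] at hj
    have e3 := mul_le_mul_of_nonneg_left e2 (by positivity : 0 ≤ 3 * (M : ℝ) ^ 2)
    rw [one_div_mul_eq_div, mul_div_assoc', div_le_iff₀ (by positivity)]
    nlinarith
  linarith

end HalpernCAT0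

theorem corollary4p4 {X : Type*} [MetricSpace X] [CompleteSpace X] [HalpernCAT0.CAT0Space X]
    (C : Set X) (hC_closed : IsClosed C) (hC_bdd : Bornology.IsBounded C)
    (hC_conv : HalpernCAT0.GeodConvex C)
    (T : X → X) (hT_maps : Set.MapsTo T C C)
    (hT_nonexp : ∀ x ∈ C, ∀ y ∈ C, dist (T x) (T y) ≤ dist x y)
    (u x : X) (hu : u ∈ C) (hx : x ∈ C)
    (M : ℕ) (hM_pos : 0 < M) (hM_diam : Metric.diam C ≤ (M : ℝ))
    (lam : ℕ → ℝ) (hlam : ∀ n : ℕ, 1 ≤ n → lam n = 1 / ((n : ℝ) + 1))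
    (ε : ℝ) (hε_pos : 0 < ε) (hε_lt : ε < 1) (g : ℕ → ℕ) :
    ∃ N : ℕ, N ≤ HalpernCAT0.SigmaBound ε g M ∧
      ∀ m ∈ Set.Icc N (N + g N), ∀ n ∈ Set.Icc N (N + g N),
        dist (HalpernCAT0.halpern T lam u x m) (HalpernCAT0.halpern T lam u x n) ≤ ε := by
  have h : HalpernCAT0.NonexpansiveOn C T u M :=
    ⟨hC_conv, hT_maps, hT_nonexp, hu, fun y hy z hz =>
      (Metric.dist_le_diam_of_mem hC_bdd hy hz).trans hM_diam⟩
  have hrec : ∀ n : ℕ, HalpernCAT0.halpern T lam u x (n + 1) =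
      HalpernCAT0.comb u (T (HalpernCAT0.halpern T lam u x n)) (((n : ℝ) + 1) / (n + 2)) := by
    intro n
    have e : 1 - lam (n + 1) = ((n : ℝ) + 1) / (n + 2) := by
      rw [hlam (n + 1) (by omega)]
      push_cast
      field_simp
      ring
    rw [HalpernCAT0.halpern, e]
  have hex : ∀ k : ℕ, ∃ z ∈ C, z = HalpernCAT0.comb u (T z) (1 - 1 / ((k : ℝ) + 1)) := by
    intro k
    refine h.exists_approximant hC_closed.isComplete ?_ ?_
    · rw [sub_nonneg, div_le_one (by positivity)]
      linarith [k.cast_nonneg (α := ℝ)]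
    · linarith [show (0 : ℝ) < 1 / ((k : ℝ) + 1) by positivity]
  choose z hz hfz using hex
  obtain ⟨k, hk, j, hj, hkj⟩ := h.exists_close_approximants hM_pos hz hfz hε_pos g
  refine ⟨HalpernCAT0.Theta M k (ε ^ 2 / 4), ?_, fun m hm n hn => ?_⟩
  · rw [← HalpernCAT0.Theta_Lnum]
    exact HalpernCAT0.Theta_mono M hk (by positivity)
  · have key : ∀ i ∈ Set.Icc (HalpernCAT0.Theta M k (ε ^ 2 / 4))
        (HalpernCAT0.Theta M k (ε ^ 2 / 4) + g (HalpernCAT0.Theta M k (ε ^ 2 / 4))),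
        dist (z j) (HalpernCAT0.halpern T lam u x i) ≤ ε / 2 := by
      intro i hi
      have := h.sq_dist_halpern_le_quarter hM_pos (x := HalpernCAT0.halpern T lam u x) hx hrec
        (hz k) (hz j) (hfz k) (hfz j) hε_pos hε_lt hkj g hj hi
      refine abs_le_of_sq_le_sq' ?_ (by positivity) |>.2
      linarith
    linarith [dist_triangle_left (HalpernCAT0.halpern T lam u x m)
      (HalpernCAT0.halpern T lam u x n) (z j), key m hm, key n hn]
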